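/- For positive integers $m,s$, let $\mathcal R[m\cdot s]$ denote the NRT poset, that is, the disjoint union of $m$ chains (blocks) with $s$ elements each. An anti-ideal of this poset is the complement of an ideal (down-closed subset). For a positive integer $t\le ms$, an ordered covering array $OCA(N;t,m,s,v)$ is an $N\times ms$ array with entries from an alphabet $V$ of size $v$, whose columns are labeled by the elements of $\mathcal R[m\cdot s]$, such that for every anti-ideal $J$ with $|J|=t$ the $N\times t$ subarray formed by the columns labeled by $J$ has every $t$-tuple over $V$ as a row at least once. Let $OCAN(t,m,s,v)$ be the smallest positive integer $N$ for which an $OCA(N;t,m,s,v)$ exists. Corollary 3.6. Let $v$ be a prime power and let $t$ be a positive integer. (1) If $t$ is odd, then $$OCAN(t,v+2,t,v)\le v^t\left(t-\frac{2}{1-v}\left(\frac{1}{v^{(t-1)/2}}-1\right)\right).$$ (2) If $t$ is even, then $$OCAN(t,v+2,t,v)\le v^t\left(t-\frac{2}{1-v}\left(\frac{1}{v^{(t-2)/2}}-1\right)-\frac{1}{v^{t/2}}\right).$$ -/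

import Mathlib

/-- The Niederreiter-Rosenbloom-Tsfasman poset with `m` blocks of size `s`: the disjoint union of
`m` chains with `s` elements each. Mathlib's order on a sigma type is the disjoint-union order, so
`⟨i, a⟩ ≤ ⟨i', b⟩` holds exactly when `i = i'` and `a ≤ b`. -/
abbrev NRT (m s : ℕ) : Type := Σ _ : Fin m, Fin s

/-- An anti-ideal of a finite poset is the complement of an ideal (a down-closed subset). -/
def IsAntiIdeal {P : Type*} [PartialOrder P] (J : Finset P) : Prop :=
  IsLowerSet ((J : Set P)ᶜ)

/-- The set `J` of columns of the array `A` (rows indexed by `R`, columns by `C`, entries in `V`)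
is covered: every tuple over `V` indexed by `J` occurs in some row of the subarray on `J`. -/
def IsCovered {R C V : Type*} (A : R → C → V) (J : Finset C) : Prop :=
  ∀ w : J → V, ∃ r : R, ∀ c : J, A r c = w c

/-- The array `A` with `N` rows and entries in the alphabet `V` is an ordered covering array of
strength `t` (and index `1`): its columns are labeled by the NRT poset, and the columns labeled by
each anti-ideal with `t` elements are covered. -/
def IsOCA {N m s : ℕ} {V : Type*} (t : ℕ) (A : Fin N → NRT m s → V) : Prop :=
  ∀ J : Finset (NRT m s), IsAntiIdeal J → J.card = t → IsCovered A J

/-- The ordered covering array number: the smallest positive integer `N` such that an ordered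
covering array with `N` rows over an alphabet of size `v` exists. -/
noncomputable def OCAN (t m s v : ℕ) : ℕ :=
  sInf {N : ℕ | 0 < N ∧ ∃ A : Fin N → NRT m s → Fin v, IsOCA t A}

/-- For a nonempty alphabet the minimum defining `OCAN` is over a nonempty set, hence attained. -/
theorem OCAN_isLeast (t m s v : ℕ) (hv : 0 < v) :
    IsLeast {N : ℕ | 0 < N ∧ ∃ A : Fin N → NRT m s → Fin v, IsOCA t A} (OCAN t m s v) := by
  have hne : {N : ℕ | 0 < N ∧ ∃ A : Fin N → NRT m s → Fin v, IsOCA t A}.Nonempty := by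
    have : Nonempty (Fin v) := ⟨⟨0, hv⟩⟩
    refine ⟨Fintype.card (NRT m s → Fin v), Fintype.card_pos,
      (Fintype.equivFin (NRT m s → Fin v)).symm, fun J _ _ w => ?_⟩
    classical
    refine ⟨Fintype.equivFin _ (fun c => if h : c ∈ J then w ⟨c, h⟩ else ⟨0, hv⟩), fun c => ?_⟩
    simp
  exact ⟨Nat.sInf_mem hne, fun N hN => Nat.sInf_le hN⟩

/-!
In a disjoint union of chains an anti-ideal takes the top `n b` elements of each block `b`, so an
array is an ordered covering array of strength `t` as soon as it realizes all entries at depth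
`< n b` in block `b`, for every profile `n` with `∑ b, n b = t` (`OCAN_le_card`).

Let `F` be a field with `v` elements and label the `v + 2` blocks by the elements of `F` and two
further blocks `x`, `y`. The rows are polynomials `f` of degree `< t`; block `α ∈ F` reads the
Taylor coefficients of `f` at `α`, and both `x` and `y` read the sequence `c₀, c₁, …` of coefficients
of `f` from the leading one downwards. A polynomial of degree `< t` which vanishes to order `n α` at
each `α`, and whose first `t - ∑ α, n α` coefficients vanish, is zero
(`eq_zero_of_taylor_coeff_eq_zero`); by counting, a profile is therefore covered whenever the first
`n x` entries of `x` and the first `n y` entries of `y` together exhaust `c₀, …, c_{n x + n y - 1}`.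
Letting `x` read `c₀, …, c_{k-1}, c_{2k}, c_{2k+1}, …` and `y` read `c_k, c_{k+1}, …`, this happens
whenever `min (n x) (n y) = k` (`exists_polyEntry_eq`).

Since `2 * min (n x) (n y) ≤ t`, the values `k = 0, …, (t - 1) / 2` suffice when `t` is odd, which
gives `(t + 1) / 2 * v ^ t` rows (`OCAN_le_of_odd`). When `t = 2 * h`, the values `k < h` leave only
the profile with `n x = n y = h`. The tuples with equal entries on the two blocks already occur for
`k = 0`, where `x` and `y` agree, so `v ^ t - v ^ h` additional rows suffice (`OCAN_le_of_even`).
Comparing with the claimed bounds comes down to `2 * ∑_{i=1}^k v⁻ⁱ ≤ k`.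
-/

/-! ### Anti-ideals and profiles -/

/-- An anti-ideal of the NRT poset consists of the top `n i` elements of each block `i`. The depth
of an element below the top of its chain is the value of its `Fin.rev`. -/
theorem IsAntiIdeal.exists_profile {m s : ℕ} {J : Finset (NRT m s)} (hJ : IsAntiIdeal J) :
    ∃ n : Fin m → ℕ, (∀ c : NRT m s, c ∈ J ↔ (c.2.rev : ℕ) < n c.1) ∧ ∑ i, n i = J.card := by
  classical
  have hup : ∀ i (a b : Fin s), a ≤ b → (⟨i, a⟩ : NRT m s) ∈ J → (⟨i, b⟩ : NRT m s) ∈ J := by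
    intro i a b hab ha
    by_contra hb
    have : (⟨i, a⟩ : NRT m s) ∈ ((J : Set (NRT m s))ᶜ) :=
      hJ (a := ⟨i, b⟩) (by simpa [Sigma.le_def] using hab) (by simpa using hb)
    exact this (by simpa using ha)
  -- The depths occurring in block `i` form a lower set of naturals, hence an initial segment.
  let D : Fin m → Finset ℕ := fun i =>
    (Finset.univ.filter fun a : Fin s => (⟨i, a⟩ : NRT m s) ∈ J).image fun a => (a.rev : ℕ)
  have hD : ∀ i (a : Fin s), (a.rev : ℕ) ∈ D i ↔ (⟨i, a⟩ : NRT m s) ∈ J := by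
    intro i a
    simp only [D, Finset.mem_image, Finset.mem_filter, Finset.mem_univ, true_and]
    constructor
    · rintro ⟨b, hb, hab⟩
      rwa [← Fin.rev_injective (Fin.ext hab)]
    · exact fun h => ⟨a, h, rfl⟩
  have hDlow : ∀ i, IsLowerSet (D i : Set ℕ) := by
    intro i d e hed hd
    simp only [D, Finset.coe_image, Set.mem_image, Finset.coe_filter, Finset.mem_univ, true_and,
      Set.mem_ofPred_eq] at hd ⊢
    obtain ⟨a, ha, rfl⟩ := hd
    refine ⟨Fin.rev ⟨e, hed.trans_lt a.rev.2⟩, hup i a _ ?_ ha, by simp⟩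
    rw [← Fin.rev_le_rev, Fin.rev_rev]
    exact hed
  have hDeq : ∀ i, D i = Finset.range (D i).card := by
    intro i
    symm
    refine Finset.eq_of_subset_of_card_le (fun d hd => ?_) (by simp)
    by_contra hd'
    have hsub : D i ⊆ Finset.range d := fun e he => by
      by_contra hde
      exact hd' (hDlow i (by simpa using hde) he)
    have := Finset.card_le_card hsub
    simp only [Finset.card_range, Finset.mem_range] at this hd
    omega
  refine ⟨fun i => (D i).card, fun c => ?_, ?_⟩
  · rw [← Finset.mem_range, ← hDeq, hD]
  · have hJs : J = Finset.univ.sigma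
        fun i => Finset.univ.filter fun a : Fin s => (⟨i, a⟩ : NRT m s) ∈ J := by
      ext ⟨i, a⟩
      simp
    conv_rhs => rw [hJs, Finset.card_sigma]
    refine Finset.sum_congr rfl fun i _ => Finset.card_image_of_injective _ fun a b hab => ?_
    exact Fin.rev_injective (Fin.ext hab)

/-- Bounds `OCAN` by an array with arbitrary row type `R`, block type `B` and alphabet `F`, whose
entries are addressed by block and depth below the top of the block. -/
theorem OCAN_le_card {t m s v : ℕ} {R B F : Type*} [Finite R] [Nonempty R] [Fintype B] [Finite F]
    (hB : Nat.card B = m) (hF : Nat.card F = v) (A : R → B → ℕ → F)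
    (hA : ∀ n : B → ℕ, ∑ b, n b = t → ∀ w : B → ℕ → F, ∃ r, ∀ b, ∀ d < n b, A r b d = w b d) :
    OCAN t m s v ≤ Nat.card R := by
  classical
  subst hB hF
  let eR := Finite.equivFin R
  let eB := Finite.equivFin B
  let eF := Finite.equivFin F
  refine Nat.sInf_le ⟨Nat.card_pos,
    fun r c => eF (A (eR.symm r) (eB.symm c.1) c.2.rev), fun J hJ hcard w => ?_⟩
  obtain ⟨n, hn, hsum⟩ := hJ.exists_profile
  obtain ⟨r, hr⟩ := hA (fun b => n (eB b))
    (by rw [Equiv.sum_comp eB n, hsum, hcard])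
    (fun b d => if h : ∃ hd : d < s, (⟨eB b, Fin.rev ⟨d, hd⟩⟩ : NRT (Nat.card B) s) ∈ J
      then eF.symm (w ⟨_, h.2⟩) else A (Classical.arbitrary R) b d)
  refine ⟨eR r, fun c => ?_⟩
  obtain ⟨⟨i, a⟩, hc⟩ := c
  have h1 := hr (eB.symm i) a.rev (by simpa using (hn _).1 hc)
  have hex : ∃ hd : (a.rev : ℕ) < s,
      (⟨eB (eB.symm i), Fin.rev ⟨a.rev, hd⟩⟩ : NRT (Nat.card B) s) ∈ J :=
    ⟨a.rev.2, by rwa [Equiv.apply_symm_apply, Fin.eta, Fin.rev_rev]⟩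
  rw [dif_pos hex] at h1
  simp only [Equiv.symm_apply_apply]
  rw [h1, Equiv.apply_symm_apply]
  have hca : (⟨eB (eB.symm i), Fin.rev ⟨a.rev, a.rev.2⟩⟩ : NRT (Nat.card B) s) = ⟨i, a⟩ := by
    rw [Equiv.apply_symm_apply, Fin.eta, Fin.rev_rev]
  exact congrArg w (Subtype.ext hca)

/-! ### The polynomial arrays -/

open Polynomial in
theorem eq_zero_of_taylor_coeff_eq_zero {F : Type*} [Field F] [Fintype F] {f : F[X]}
    (n : F → ℕ) (hn : ∀ α, ∀ d < n α, (taylor α f).coeff d = 0)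
    (hdeg : f.degree < (∑ α, n α : ℕ)) : f = 0 := by
  have hdvd : ∏ α : F, (X - C α) ^ n α ∣ f := by
    refine Finset.prod_dvd_of_coprime (fun α _ β _ hαβ => ?_) fun α _ => ?_
    · exact (pairwise_coprime_X_sub_C Function.injective_id hαβ).pow
    · rw [X_sub_C_pow_dvd_iff, X_pow_dvd_iff]
      exact hn α
  refine eq_zero_of_dvd_of_degree_lt hdvd ?_
  rw [degree_prod]
  simpa [degree_pow] using hdeg

open Polynomial in
/-- The entry at depth `d` of block `b` in the row of `f`, in the `k`-th polynomial array: the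
blocks `some (some α)` read the Taylor coefficients at `α`, the blocks `some none` and `none` (the
blocks `x` and `y` above) read the coefficients of `f` downwards from that of degree `t - 1`, the
first omitting those with index in `[k, 2k)`, the second those with index in `[0, k)`. Indices
beyond the constant coefficient are truncated; no covering argument uses those entries. -/
noncomputable def polyEntry {F : Type*} [Field F] (t k : ℕ) (f : F[X]) :
    Option (Option F) → ℕ → F
  | some (some α), d => (taylor α f).coeff d
  | some none, d => f.coeff (t - 1 - if d < k then d else d + k)
  | none, d => f.coeff (t - 1 - (k + d))

open Polynomial in
theorem polyEntry_sub {F : Type*} [Field F] (t k : ℕ) (f g : F[X]) (b : Option (Option F)) (d : ℕ) :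
    polyEntry t k (f - g) b d = polyEntry t k f b d - polyEntry t k g b d := by
  rcases b with _ | _ | α <;> simp [polyEntry]

open Polynomial in
theorem eq_zero_of_polyEntry_eq_zero {F : Type*} [Field F] [Fintype F] {t k : ℕ} {f : F[X]}
    (hf : f ∈ degreeLT F t) (n : Option (Option F) → ℕ) (hn : ∑ b, n b = t)
    (hk : min (n (some none)) (n none) = k)
    (h0 : ∀ b, ∀ d < n b, polyEntry t k f b d = 0) : f = 0 := by
  rw [Fintype.sum_option, Fintype.sum_option] at hn
  refine eq_zero_of_taylor_coeff_eq_zero (fun α => n (some (some α))) (fun α => h0 _) ?_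
  rw [degree_lt_iff_coeff_zero]
  intro i hi
  rw [mem_degreeLT, degree_lt_iff_coeff_zero] at hf
  by_cases hit : t ≤ i
  · exact hf i hit
  have hx := h0 (some none)
  have hy := h0 none
  simp only [polyEntry] at hx hy
  obtain ⟨j, hj⟩ : ∃ j, j = t - 1 - i := ⟨_, rfl⟩
  have hij : i = t - 1 - j := by omega
  rw [hij]
  rcases lt_or_ge j k with hjk | hjk
  · simpa [hjk] using hx j (by omega)
  rcases lt_or_ge (j - k) (n none) with hjy | hjy
  · have := hy (j - k) hjy
    rwa [Nat.add_sub_cancel' hjk] at this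
  · -- Index `j` lies beyond the reach of `y`, so `n none = k` and block `x` reads it.
    have := hx (j - k) (by omega)
    rwa [if_neg (by omega), Nat.sub_add_cancel hjk] at this

open Polynomial in
instance finite_degreeLT {F : Type*} [Field F] [Finite F] (t : ℕ) : Finite (degreeLT F t) :=
  Finite.of_equiv _ (degreeLTEquiv F t).symm.toEquiv

open Polynomial in
theorem natCard_degreeLT {F : Type*} [Field F] [Finite F] (t : ℕ) :
    Nat.card (degreeLT F t) = Nat.card F ^ t := by
  rw [Nat.card_congr (degreeLTEquiv F t).toEquiv, Nat.card_fun, Nat.card_fin]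

open Polynomial in
theorem exists_polyEntry_eq {F : Type*} [Field F] [Fintype F] {t : ℕ}
    (n : Option (Option F) → ℕ) (hn : ∑ b, n b = t) (w : Option (Option F) → ℕ → F) :
    ∃ f : degreeLT F t, ∀ b, ∀ d < n b,
      polyEntry t (min (n (some none)) (n none)) (f : F[X]) b d = w b d := by
  let Φ : degreeLT F t → ((Σ b, Fin (n b)) → F) :=
    fun f c => polyEntry t (min (n (some none)) (n none)) (f : F[X]) c.1 c.2
  have hinj : Function.Injective Φ := by
    intro f g hfg
    refine Subtype.ext (sub_eq_zero.1 ?_)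
    refine eq_zero_of_polyEntry_eq_zero (f - g).2 n hn rfl fun b d hd => ?_
    rw [polyEntry_sub, sub_eq_zero]
    exact congrFun hfg ⟨b, d, hd⟩
  have hbij := (Nat.bijective_iff_injective_and_card Φ).2 ⟨hinj, by
    rw [natCard_degreeLT, Nat.card_fun, Nat.card_sigma]
    simp [hn]⟩
  obtain ⟨f, hf⟩ := hbij.2 fun c => w c.1 c.2
  exact ⟨f, fun b d hd => congrFun hf ⟨b, d, hd⟩⟩

/-! ### Bounds on the ordered covering array number -/

theorem natCard_option_option {F : Type*} [Finite F] :
    Nat.card (Option (Option F)) = Nat.card F + 2 := by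
  rw [Finite.card_option, Finite.card_option]

open Polynomial in
theorem OCAN_le_of_odd (F : Type*) [Field F] [Finite F] {t : ℕ} (ht : Odd t) (s : ℕ) :
    OCAN t (Nat.card F + 2) s (Nat.card F) ≤ (t + 1) / 2 * Nat.card F ^ t := by
  have := Fintype.ofFinite F
  obtain ⟨u, rfl⟩ := ht
  have : Nonempty (Fin ((2 * u + 1 + 1) / 2)) := ⟨⟨0, by omega⟩⟩
  have h := OCAN_le_card (t := 2 * u + 1) (s := s)
    (R := Fin ((2 * u + 1 + 1) / 2) × degreeLT F (2 * u + 1))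
    natCard_option_option (rfl : Nat.card F = _)
    (fun r => polyEntry (2 * u + 1) r.1 (r.2 : F[X])) (fun n hn w => ?_)
  · rwa [Nat.card_prod, Nat.card_fin, natCard_degreeLT] at h
  · obtain ⟨f, hf⟩ := exists_polyEntry_eq n hn w
    rw [Fintype.sum_option, Fintype.sum_option] at hn
    exact ⟨(⟨min (n (some none)) (n none), by omega⟩, f), hf⟩

/-- The additional rows for even strength `2 * h`: block `some none` reads `p`, block `none` reads
`q`, and all other entries are zero. -/
def pairEntry {F : Type*} [Zero F] {h : ℕ} (p q : Fin h → F) : Option (Option F) → ℕ → F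
  | some (some _), _ => 0
  | some none, d => if hd : d < h then p ⟨d, hd⟩ else 0
  | none, d => if hd : d < h then q ⟨d, hd⟩ else 0

open Polynomial in
/-- In the array with `k = 0` the blocks `some none` and `none` are equal and read arbitrary
sequences. -/
theorem exists_polyEntry_zero_eq {F : Type*} [Field F] (h : ℕ) (p : Fin h → F) :
    ∃ f : degreeLT F (2 * h), ∀ d (hd : d < h),
      polyEntry (2 * h) 0 (f : F[X]) (some none) d = p ⟨d, hd⟩ ∧
      polyEntry (2 * h) 0 (f : F[X]) none d = p ⟨d, hd⟩ := by
  let g : Fin (2 * h) → F := fun i => if hi : 2 * h - 1 - i < h then p ⟨2 * h - 1 - i, hi⟩ else 0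
  refine ⟨(degreeLTEquiv F (2 * h)).symm g, fun d hd => ?_⟩
  have hlt : 2 * h - 1 - d < 2 * h := by omega
  have key : (((degreeLTEquiv F (2 * h)).symm g : degreeLT F (2 * h)) : F[X]).coeff
      (2 * h - 1 - d) = p ⟨d, hd⟩ := by
    have h1 := congrFun ((degreeLTEquiv F (2 * h)).apply_symm_apply g) ⟨2 * h - 1 - d, hlt⟩
    have h2 : 2 * h - 1 - (2 * h - 1 - d) = d := by omega
    simp only [g, h2, dif_pos hd] at h1
    exact h1
  simp [polyEntry, key]

open Polynomial in
theorem OCAN_le_of_even (F : Type*) [Field F] [Finite F] {h : ℕ} (hh : 0 < h) (s : ℕ) :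
    OCAN (2 * h) (Nat.card F + 2) s (Nat.card F) ≤
      h * Nat.card F ^ (2 * h) + (Nat.card F ^ (2 * h) - Nat.card F ^ h) := by
  classical
  have := Fintype.ofFinite F
  have : Nonempty (Fin h) := ⟨⟨0, hh⟩⟩
  have hle := OCAN_le_card (t := 2 * h) (s := s)
    (R := (Fin h × degreeLT F (2 * h)) ⊕ ((Finset.univ : Finset (Fin h → F)).offDiag))
    natCard_option_option (rfl : Nat.card F = _)
    (Sum.elim (fun r => polyEntry (2 * h) r.1 (r.2 : F[X]))
      (fun r => pairEntry (r : (Fin h → F) × (Fin h → F)).1 (r : (Fin h → F) × (Fin h → F)).2))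
    (fun n hn w => ?_)
  · rw [Nat.card_sum, Nat.card_prod, Nat.card_fin, natCard_degreeLT, Nat.card_eq_finsetCard,
      Finset.offDiag_card, Finset.card_univ, Fintype.card_fun,
      Fintype.card_fin, ← pow_add, ← two_mul, ← Nat.card_eq_fintype_card (α := F)] at hle
    exact hle
  · obtain ⟨f, hf⟩ := exists_polyEntry_eq n hn w
    rw [Fintype.sum_option, Fintype.sum_option] at hn
    by_cases hk : min (n (some none)) (n none) < h
    · exact ⟨Sum.inl (⟨_, hk⟩, f), hf⟩
    have hx : n (some none) = h := by omega
    have hy : n none = h := by omega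
    have hα : ∀ α, n (some (some α)) = 0 := by
      have : ∑ α, n (some (some α)) = 0 := by omega
      simpa using this
    let p : Fin h → F := fun d => w (some none) d
    let q : Fin h → F := fun d => w none d
    by_cases hpq : p = q
    · obtain ⟨f, hf⟩ := exists_polyEntry_zero_eq h p
      refine ⟨Sum.inl (⟨0, hh⟩, f), fun b d hd => ?_⟩
      rcases b with _ | _ | α
      · exact (hf d (hy ▸ hd)).2.trans (congrFun hpq ⟨d, hy ▸ hd⟩)
      · exact (hf d (hx ▸ hd)).1
      · simp [hα] at hd
    · refine ⟨Sum.inr ⟨(p, q), by simpa using hpq⟩, fun b d hd => ?_⟩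
      rcases b with _ | _ | α
      · rw [hy] at hd
        simp [pairEntry, hd, q]
      · rw [hx] at hd
        simp [pairEntry, hd, p]
      · simp [hα] at hd

/-! ### Comparison with the closed form -/

/-- The left-hand side is `2 * ∑_{i=1}^k x⁻ⁱ`. -/
theorem two_div_one_sub_mul_le {x : ℝ} (hx : 2 ≤ x) (k : ℕ) :
    2 / (1 - x) * (1 / x ^ k - 1) ≤ k := by
  have h1 : 1 - x ≠ 0 := by linarith
  have h0 : x ≠ 0 := by linarith
  induction k with
  | zero => simp
  | succ k ih =>
    have hstep : 2 / (1 - x) * (1 / x ^ (k + 1) - 1) =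
        2 / (1 - x) * (1 / x ^ k - 1) + 2 / x ^ (k + 1) := by
      field_simp
      ring
    have hpow : 2 / x ^ (k + 1) ≤ 1 := by
      rw [div_le_one (by positivity)]
      exact hx.trans (le_self_pow₀ (by linarith) (by omega))
    rw [hstep]
    push_cast
    linarith

theorem corollary3p6 (v t : ℕ) (hv : IsPrimePow v) (ht : 1 ≤ t) :
    (Odd t →
      (OCAN t (v + 2) t v : ℝ) ≤
        (v : ℝ) ^ t *
          ((t : ℝ) - 2 / (1 - (v : ℝ)) * (1 / (v : ℝ) ^ ((t - 1) / 2) - 1))) ∧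
    (Even t →
      (OCAN t (v + 2) t v : ℝ) ≤
        (v : ℝ) ^ t *
          ((t : ℝ) - 2 / (1 - (v : ℝ)) * (1 / (v : ℝ) ^ ((t - 2) / 2) - 1)
            - 1 / (v : ℝ) ^ (t / 2))) := by
  have hv2 : (2 : ℝ) ≤ v := by exact_mod_cast hv.two_le
  obtain ⟨p, n, hp, hn, rfl⟩ := hv
  have : Fact p.Prime := ⟨hp.nat_prime⟩
  have hcard : Nat.card (GaloisField p n) = p ^ n := GaloisField.card p n hn.ne'
  have : Finite (GaloisField p n) := Nat.finite_of_card_ne_zero (by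
    rw [hcard]; exact pow_ne_zero _ hp.nat_prime.ne_zero)
  generalize p ^ n = v at *
  constructor
  · intro hodd
    have h := OCAN_le_of_odd (GaloisField p n) hodd t
    rw [hcard] at h
    obtain ⟨u, rfl⟩ := hodd
    rw [show (2 * u + 1 + 1) / 2 = u + 1 by omega] at h
    rw [show (2 * u + 1 - 1) / 2 = u by omega]
    refine (Nat.cast_le.2 h).trans ?_
    push_cast
    rw [mul_comm]
    gcongr
    linarith [two_div_one_sub_mul_le hv2 u]
  · rintro ⟨u, rfl⟩
    obtain ⟨u, rfl⟩ : ∃ k, u = k + 1 := ⟨u - 1, by omega⟩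
    have h := OCAN_le_of_even (GaloisField p n) (h := u + 1) (Nat.succ_pos u) (2 * (u + 1))
    rw [hcard] at h
    rw [← two_mul, show (2 * (u + 1) - 2) / 2 = u by omega, show 2 * (u + 1) / 2 = u + 1 by omega]
    refine (Nat.cast_le.2 h).trans ?_
    have hle : v ^ (u + 1) ≤ v ^ (2 * (u + 1)) :=
      Nat.pow_le_pow_right (by exact_mod_cast (by linarith : (0 : ℝ) < v)) (by omega)
    push_cast [Nat.cast_sub hle]
    have hrow : (v : ℝ) ^ (u + 1) = (v : ℝ) ^ (2 * (u + 1)) * (1 / (v : ℝ) ^ (u + 1)) := by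
      rw [two_mul, pow_add _ (u + 1) (u + 1), mul_one_div, mul_div_cancel_right₀ _ (pow_ne_zero _ (by linarith))]
    have hbound := mul_le_mul_of_nonneg_left (two_div_one_sub_mul_le hv2 u)
      (by positivity : 0 ≤ (v : ℝ) ^ (2 * (u + 1)))
    linear_combination hbound - hrow
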